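/- There is an absolute constant $\alpha\ge 1$ such that the following holds. Let $n,m\ge 0$ be integers, let $A\in\{0,1\}^{n\times m}$, and let $D_1,\dots,D_m$ be probability distributions on $[0,\infty)$. Then there is a threshold $\tau\ge 0$, depending only on $A$ and $D_1,\dots,D_m$, such that whenever $Y_1,\dots,Y_m$ are independent random variables with $Y_j\sim D_j$ and $X=AY$, i.e. $X_i=\sum_{j} A_{ij}Y_j$ for $1\le i\le n$, $$\mathbb{E}[\mathrm{ALG}_\tau]\;\ge\;\frac1\alpha\,\mathbb{E}\Big[\max_{1\le i\le n} X_i\Big],$$ where $\mathrm{ALG}_\tau$ denotes the reward of the fixed-threshold algorithm that observes $X_1,X_2,\dots,X_n$ in this order and takes the first $X_i$ with $X_i>\tau$; that is, $\mathrm{ALG}_\tau=X_i$ for the smallest $i$ with $X_i>\tau$, and $\mathrm{ALG}_\tau=0$ if there is no such $i$. (Expectations are taken in $[0,\infty]$, so if $\mathbb{E}[\max_i X_i]=\infty$ then $\mathbb{E}[\mathrm{ALG}_\tau]=\infty$ is asserted; the maximum over an empty set is $0$.) In other words, the unweighted linear correlations prophet problem has a fixed-threshold constant-factor approximation algorithm.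 -/

import Mathlib

open MeasureTheory ProbabilityTheory
open scoped NNReal ENNReal

namespace LinearProphet

/-- The option values `X = A · Y`, i.e. `X i = ∑ j, A i j * Y j`, in the linear correlations
model with nonnegative coefficient matrix `A` and nonnegative feature values `y`. -/
noncomputable def optionValues {n m : ℕ} (A : Matrix (Fin n) (Fin m) ℝ≥0) (y : Fin m → ℝ≥0) : Fin n → ℝ≥0 :=
  A.mulVec y

/-- The unweighted model: every entry of `A` is `0` or `1`. -/
def IsUnweighted {n m : ℕ} (A : Matrix (Fin n) (Fin m) ℝ≥0) : Prop :=
  ∀ i j, A i j = 0 ∨ A i j = 1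

/-- The reward of the prophet, `max_i x i` (equal to `0` if there are no options). -/
noncomputable def prophetReward {n : ℕ} (x : Fin n → ℝ≥0) : ℝ≥0 :=
  Finset.univ.sup x

/-- The reward of the fixed-threshold algorithm with threshold `τ` on the arrival sequence
`x 0, x 1, …`: it takes the first arrival that exceeds `τ`, and gets `0` if there is none. -/
noncomputable def fixedThresholdReward {n : ℕ} (τ : ℝ≥0) (x : Fin n → ℝ≥0) : ℝ≥0 :=
  if h : ∃ i, τ < x i then x (Fin.find (fun i => τ < x i) h) else 0

end LinearProphet

/-!
Let `τ` be the smallest median of `M = max_i X_i`. Replacing each feature `Y_j` by `min (Y_j) τ`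
changes `M` by at most `∑ j, (Y_j - τ)⁺`, the sum being over the features that enter some option.

The truncated maximum is a monotone subadditive function of independent features, each of which
contributes at most `τ` on its own. The Hoffmann-Jørgensen inequality then makes its tail decay
geometrically from the median on, so that its expectation is at most `4 τ`.

Threshold `τ / 2` earns at least `τ / 2` with probability at least `1 / 2`. Threshold `τ` earns at
least `Y_j` whenever `Y_j > τ` and all the other features together keep every option at or below
`τ`: since entries are `0` or `1`, the accepted option must then contain feature `j`. The second
condition is independent of `Y_j` and has probability at least `1 / 2`, and no two features can
satisfy both, which pays for half of the excess. The better of the two thresholds is therefore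
within a factor `16 + 2`.
-/

open Filter Topology

namespace LinearProphet

section Measure

lemma exists_isLeast_measure_Ioi_le (ν : Measure ℝ≥0) [IsFiniteMeasure ν] {p : ℝ≥0∞}
    (hp : p ≠ 0) : ∃ τ, IsLeast {t | ν (Set.Ioi t) ≤ p} τ := by
  set T := {t | ν (Set.Ioi t) ≤ p}
  have hT : T.Nonempty := by
    have hinter : ⋂ t : ℝ≥0, Set.Ioi t = ∅ := by
      simpa [Set.eq_empty_iff_forall_notMem] using fun x : ℝ≥0 => ⟨x, le_rfl⟩
    have hlim : Tendsto (fun t => ν (Set.Ioi t)) atTop (𝓝 0) := by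
      rw [← measure_empty (μ := ν), ← hinter]
      exact tendsto_measure_iInter_atTop (fun _ => measurableSet_Ioi.nullMeasurableSet)
        (fun _ _ h => Set.Ioi_subset_Ioi h) ⟨0, measure_ne_top _ _⟩
    obtain ⟨t, ht⟩ := (hlim.eventually_lt_const (pos_iff_ne_zero.2 hp)).exists
    exact ⟨t, ht.le⟩
  obtain ⟨u, hanti, hlim, hu⟩ := exists_seq_tendsto_sInf hT (OrderBot.bddBelow T)
  -- The infimum is attained since the distribution function of `ν` is right continuous.
  refine ⟨sInf T, ?_, fun t ht => csInf_le (OrderBot.bddBelow T) ht⟩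
  have hmono : Monotone fun k => Set.Ioi (u k) := fun _ _ h => Set.Ioi_subset_Ioi (hanti h)
  rw [Set.mem_ofPred_eq, ← (isGLB_of_tendsto_atTop hanti hlim).iUnion_Ioi_eq, hmono.measure_iUnion]
  exact iSup_le hu

variable {Ω : Type*} [MeasurableSpace Ω] {μ : Measure Ω}

lemma exists_isLeast_measure_lt_le [IsFiniteMeasure μ] {M : Ω → ℝ≥0} (hM : Measurable M)
    {p : ℝ≥0∞} (hp : p ≠ 0) : ∃ τ, IsLeast {t | μ {ω | t < M ω} ≤ p} τ := by
  simpa only [Measure.map_apply hM measurableSet_Ioi, Set.preimage, Set.mem_Ioi] using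
    exists_isLeast_measure_Ioi_le (μ.map M) hp

lemma lintegral_coe_nnreal_eq_lintegral_measure_lt {F : Ω → ℝ≥0} (hF : Measurable F) :
    ∫⁻ ω, F ω ∂μ = ∫⁻ t in Set.Ioi (0 : ℝ), μ {ω | t < (F ω : ℝ)} := by
  simpa only [ENNReal.ofReal_coe_nnreal] using
    lintegral_eq_lintegral_meas_lt μ (Eventually.of_forall fun ω => (F ω).coe_nonneg)
      hF.coe_nnreal_real.aemeasurable

lemma lintegral_le_two_mul_of_measure_add_lt_le [IsProbabilityMeasure μ] {F : Ω → ℝ≥0}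
    (hF : Measurable F) (hfin : ∫⁻ ω, F ω ∂μ ≠ ∞) {a : ℝ≥0}
    (htail : ∀ t, μ {ω | t + a < F ω} ≤ 1 / 2 * μ {ω | t < F ω}) :
    ∫⁻ ω, F ω ∂μ ≤ 2 * a := by
  set I := ∫⁻ ω, F ω ∂μ with hI
  have hexcess : ∫⁻ ω, (F ω - a : ℝ≥0) ∂μ ≤ I / 2 := by
    rw [hI, ENNReal.div_eq_inv_mul, ← one_div, lintegral_coe_nnreal_eq_lintegral_measure_lt hF,
      lintegral_coe_nnreal_eq_lintegral_measure_lt (hF.sub_const a),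
      ← lintegral_const_mul' _ _ (by simp)]
    refine setLIntegral_mono' measurableSet_Ioi fun t ht => ?_
    lift t to ℝ≥0 using le_of_lt ht
    simpa only [NNReal.coe_lt_coe, lt_tsub_iff_right] using htail t
  have hsplit : I / 2 + I / 2 ≤ a + I / 2 :=
    calc I / 2 + I / 2 = I := ENNReal.add_halves I
      _ ≤ ∫⁻ ω, (a + (F ω - a : ℝ≥0)) ∂μ :=
        lintegral_mono fun ω => by
          rw [← ENNReal.coe_add]
          exact ENNReal.coe_le_coe.2 le_add_tsub
      _ = a + ∫⁻ ω, (F ω - a : ℝ≥0) ∂μ := by simp [lintegral_add_left measurable_const]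
      _ ≤ a + I / 2 := by gcongr
  have hhalf : I / 2 ≤ a :=
    (ENNReal.add_le_add_iff_right (ENNReal.div_ne_top hfin two_ne_zero)).1 hsplit
  rwa [mul_comm, ← ENNReal.div_le_iff two_ne_zero ENNReal.ofNat_ne_top]

lemma setLIntegral_preimage_of_indepFun {β : Type*} [MeasurableSpace β] {f : Ω → ℝ≥0∞} {g : Ω → β}
    (hf : Measurable f) (hg : Measurable g) (hindep : IndepFun f g μ) {B : Set β}
    (hB : MeasurableSet B) :
    ∫⁻ ω in g ⁻¹' B, f ω ∂μ = μ (g ⁻¹' B) * ∫⁻ ω, f ω ∂μ := by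
  have hind : Measurable (B.indicator (1 : β → ℝ≥0∞)) := measurable_one.indicator hB
  calc ∫⁻ ω in g ⁻¹' B, f ω ∂μ = ∫⁻ ω, (B.indicator 1 ∘ g) ω * f ω ∂μ := by
        rw [← lintegral_indicator (hg hB)]
        refine lintegral_congr fun ω => ?_
        by_cases hω : g ω ∈ B <;> simp [hω]
    _ = (∫⁻ ω, (B.indicator 1 ∘ g) ω ∂μ) * ∫⁻ ω, f ω ∂μ :=
        lintegral_mul_eq_lintegral_mul_lintegral_of_indepFun (hind.comp hg) hf
          (hindep.symm.comp hind measurable_id)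
    _ = μ (g ⁻¹' B) * ∫⁻ ω, f ω ∂μ :=
        congrArg (· * _) (lintegral_indicator_one (hg hB))

end Measure

section HoffmannJorgensen

variable {ι E : Type*} [MeasurableSpace E]

lemma measurable_indicator_pi [Zero E] (S : Set ι) :
    Measurable fun y : ι → E => S.indicator y := by
  refine measurable_pi_lambda _ fun j => ?_
  by_cases hj : j ∈ S
  · simpa [hj] using measurable_pi_apply j
  · simp [hj]

lemma indepFun_indicator_pi [Zero E] [Fintype ι] {D : ι → Measure E}
    [∀ j, IsProbabilityMeasure (D j)] {S T : Set ι} (hST : Disjoint S T) :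
    IndepFun (fun y : ι → E => S.indicator y) (fun y => T.indicator y) (Measure.pi D) := by
  classical
  have hcoord : iIndepFun (fun (j : ι) (y : ι → E) => y j) (Measure.pi D) :=
    iIndepFun_pi (X := fun _ x => x) fun _ => aemeasurable_id
  let extend (U : Finset ι) (z : U → E) (j : ι) : E := if hj : j ∈ U then z ⟨j, hj⟩ else 0
  have hextend (U : Finset ι) : Measurable (extend U) := by
    refine measurable_pi_lambda _ fun j => ?_
    by_cases hj : j ∈ U
    · simpa [extend, hj] using measurable_pi_apply _
    · simp [extend, hj]
  have hindicator (U : Finset ι) :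
      (fun y : ι → E => (U : Set ι).indicator y) = extend U ∘ fun y i => y i := by
    ext y j
    by_cases hj : j ∈ U <;> simp [extend, hj]
  lift S to Finset ι using S.toFinite
  lift T to Finset ι using T.toFinite
  rw [hindicator, hindicator]
  exact (hcoord.indepFun_finset S T (mod_cast hST) measurable_pi_apply).comp (hextend S) (hextend T)

/-- The event that a functional `F`, evaluated on the coordinates revealed so far, first exceeds `t`
when coordinate `a` is added to the set `S`. It drives the decomposition according to the first
passage over `t` in the proof of the Hoffmann-Jørgensen inequality. -/
def crossing [Zero E] (F : (ι → E) → ℝ≥0) (t : ℝ≥0) (S : Set ι) (a : ι) : Set (ι → E) :=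
  {y | F (S.indicator y) ≤ t} ∩ {y | t < F ((insert a S).indicator y)}

lemma measurableSet_crossing [Zero E] {F : (ι → E) → ℝ≥0} (hF : Measurable F) (t : ℝ≥0)
    (S : Set ι) (a : ι) : MeasurableSet (crossing F t S a) :=
  (measurableSet_le (hF.comp (measurable_indicator_pi S)) measurable_const).inter
    (measurableSet_lt measurable_const (hF.comp (measurable_indicator_pi _)))

variable [AddCommMonoid E] [PartialOrder E]

/-- Monotone subadditive functionals of a family of coordinates whose value on a family supported
at one coordinate is at most `c`. They play the part of the norm of a sum of random vectors of norm
at most `c` in the Hoffmann-Jørgensen inequality. -/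
structure IsSubadditiveFunctional [DecidableEq ι] (c : ℝ≥0) (F : (ι → E) → ℝ≥0) : Prop where
  measurable : Measurable F
  monotone : Monotone F
  map_zero : F 0 = 0
  map_add_le : ∀ x y, F (x + y) ≤ F x + F y
  map_single_le : ∀ j x, F (Pi.single j x) ≤ c

namespace IsSubadditiveFunctional

variable [DecidableEq ι] {c : ℝ≥0} {F : (ι → E) → ℝ≥0}

lemma le_card_mul [Fintype ι] (hF : IsSubadditiveFunctional c F) (y : ι → E) :
    F y ≤ Fintype.card ι * c :=
  calc F y = F (∑ j, Pi.single j (y j)) := by rw [Finset.univ_sum_single]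
    _ ≤ ∑ j, F (Pi.single j (y j)) :=
      Finset.le_sum_of_subadditive F hF.map_zero.le hF.map_add_le _ _
    _ ≤ ∑ _j : ι, c := Finset.sum_le_sum fun j _ => hF.map_single_le j (y j)
    _ = Fintype.card ι * c := by simp

lemma lt_indicator_compl_of_indicator_le (hF : IsSubadditiveFunctional c F) {s t : ℝ≥0}
    {S : Set ι} {a : ι} (ha : a ∉ S) {y : ι → E} (hS : F (S.indicator y) ≤ t)
    (hy : t + c + s < F y) : s < F ((insert a S)ᶜ.indicator y) := by
  have hdecomp : y = S.indicator y + Pi.single a (y a) + (insert a S)ᶜ.indicator y := by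
    ext j
    by_cases hj : j = a
    · subst hj; simp [ha]
    · by_cases hjS : j ∈ S <;> simp [hj, hjS]
  by_contra! hrest
  refine hy.not_ge ?_
  calc F y = F (S.indicator y + Pi.single a (y a) + (insert a S)ᶜ.indicator y) := by rw [← hdecomp]
    _ ≤ F (S.indicator y) + F (Pi.single a (y a)) + F ((insert a S)ᶜ.indicator y) :=
      (hF.map_add_le _ _).trans (by gcongr; exact hF.map_add_le _ _)
    _ ≤ t + c + s := by gcongr; exact hF.map_single_le a (y a)

variable [CanonicallyOrderedAdd E]

lemma indicator_le (hF : IsSubadditiveFunctional c F) (S : Set ι) (y : ι → E) :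
    F (S.indicator y) ≤ F y :=
  hF.monotone (Set.indicator_le_self S y)

variable [Fintype ι] {D : ι → Measure E} [∀ j, IsProbabilityMeasure (D j)]

-- Once the coordinates in `insert a S` are revealed, exceeding `t + c + s` is up to the others,
-- which are independent of them.
lemma measure_crossing_inter_le (hF : IsSubadditiveFunctional c F) (s t : ℝ≥0) {S : Set ι} {a : ι}
    (ha : a ∉ S) :
    Measure.pi D (crossing F t S a ∩ {y | t + c + s < F y}) ≤
      Measure.pi D (crossing F t S a) * Measure.pi D {y | s < F y} := by
  set past : Set (ι → E) := {z | F (S.indicator z) ≤ t} ∩ {z | t < F z}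
  have hpast : MeasurableSet past :=
    (measurableSet_le (hF.measurable.comp (measurable_indicator_pi S)) measurable_const).inter
      (measurableSet_lt measurable_const hF.measurable)
  have hcrossing : crossing F t S a = (fun y => (insert a S).indicator y) ⁻¹' past := by
    ext y
    simp [crossing, past, Set.indicator_indicator, Set.inter_eq_left.2 (Set.subset_insert a S)]
  calc Measure.pi D (crossing F t S a ∩ {y | t + c + s < F y})
      ≤ Measure.pi D (crossing F t S a ∩ {y | s < F ((insert a S)ᶜ.indicator y)}) :=
        measure_mono fun y hy => ⟨hy.1, hF.lt_indicator_compl_of_indicator_le ha hy.1.1 hy.2⟩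
    _ = Measure.pi D (crossing F t S a) * Measure.pi D {y | s < F ((insert a S)ᶜ.indicator y)} := by
        rw [hcrossing]
        exact (indepFun_indicator_pi disjoint_compl_right).measure_inter_preimage_eq_mul _
          {z | s < F z} hpast (measurableSet_lt measurable_const hF.measurable)
    _ ≤ Measure.pi D (crossing F t S a) * Measure.pi D {y | s < F y} := by
        gcongr
        exact hF.indicator_le _ _

lemma measure_indicator_inter_le (hF : IsSubadditiveFunctional c F) (s t : ℝ≥0) (S : Set ι) :
    Measure.pi D ({y | t < F (S.indicator y)} ∩ {y | t + c + s < F y}) ≤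
      Measure.pi D {y | t < F (S.indicator y)} * Measure.pi D {y | s < F y} := by
  induction S, S.toFinite using Set.Finite.induction_on with
  | empty =>
    have hempty (y : ι → E) : F ((∅ : Set ι).indicator y) = 0 := by
      rw [Set.indicator_empty', hF.map_zero]
    simp only [hempty]
    simp
  | @insert a S ha _ ih =>
    set μ := Measure.pi D
    set above : Set (ι → E) := {y | t < F (S.indicator y)}
    set high : Set (ι → E) := {y | t + c + s < F y}
    have hsplit : {y | t < F ((insert a S).indicator y)} = above ∪ crossing F t S a := by
      ext y
      have hle : F (S.indicator y) ≤ F ((insert a S).indicator y) :=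
        hF.monotone (Set.indicator_le_indicator_of_subset (Set.subset_insert a S) fun _ => zero_le)
      simp only [above, crossing, Set.mem_ofPred_eq, Set.mem_union, Set.mem_inter_iff]
      grind
    have hdisj : Disjoint above (crossing F t S a) :=
      Set.disjoint_left.2 fun y (hy : t < F (S.indicator y)) hy' => hy.not_ge hy'.1
    rw [hsplit, Set.union_inter_distrib_right]
    calc μ (above ∩ high ∪ crossing F t S a ∩ high)
        ≤ μ (above ∩ high) + μ (crossing F t S a ∩ high) := measure_union_le _ _
      _ ≤ μ above * μ {y | s < F y} + μ (crossing F t S a) * μ {y | s < F y} :=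
          add_le_add ih (hF.measure_crossing_inter_le s t ha)
      _ = μ (above ∪ crossing F t S a) * μ {y | s < F y} := by
          rw [measure_union hdisj (measurableSet_crossing hF.measurable t S a), add_mul]

theorem hoffmannJorgensen (hF : IsSubadditiveFunctional c F) (s t : ℝ≥0) :
    Measure.pi D {y | t + c + s < F y} ≤
      Measure.pi D {y | t < F y} * Measure.pi D {y | s < F y} := by
  have hsub : {y | t + c + s < F y} ⊆ {y | t < F y} := fun y (hy : t + c + s < F y) =>
    (le_self_add.trans le_self_add).trans_lt hy
  simpa only [Set.indicator_univ, Set.inter_eq_right.2 hsub] using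
    hF.measure_indicator_inter_le s t Set.univ

theorem lintegral_le_four_mul (hF : IsSubadditiveFunctional c F)
    (hmed : Measure.pi D {y | c < F y} ≤ 1 / 2) : ∫⁻ y, F y ∂Measure.pi D ≤ 4 * c := by
  have hfin : ∫⁻ y, F y ∂Measure.pi D ≠ ∞ :=
    ne_top_of_le_ne_top (b := ((Fintype.card ι * c : ℝ≥0) : ℝ≥0∞)) ENNReal.coe_ne_top <|
      (lintegral_mono fun y => ENNReal.coe_le_coe.2 (hF.le_card_mul y)).trans_eq (by simp)
  have htail (t : ℝ≥0) :
      Measure.pi D {y | t + (c + c) < F y} ≤ 1 / 2 * Measure.pi D {y | t < F y} := by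
    rw [← add_assoc, mul_comm]
    exact (hF.hoffmannJorgensen c t).trans (by gcongr)
  calc ∫⁻ y, F y ∂Measure.pi D ≤ 2 * (c + c : ℝ≥0) :=
        lintegral_le_two_mul_of_measure_add_lt_le hF.measurable hfin htail
    _ = 4 * c := by push_cast; ring

end IsSubadditiveFunctional

end HoffmannJorgensen

section Options

variable {n m : ℕ} {A : Matrix (Fin n) (Fin m) ℝ≥0}

lemma le_prophetReward (x : Fin n → ℝ≥0) (i : Fin n) : x i ≤ prophetReward x :=
  Finset.le_sup (Finset.mem_univ i)

lemma prophetReward_le_iff {x : Fin n → ℝ≥0} {c : ℝ≥0} : prophetReward x ≤ c ↔ ∀ i, x i ≤ c := by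
  simp [prophetReward]

lemma prophetReward_monotone : Monotone (prophetReward (n := n)) :=
  fun _ _ h => Finset.sup_mono_fun fun i _ => h i

lemma prophetReward_add_le (x z : Fin n → ℝ≥0) :
    prophetReward (x + z) ≤ prophetReward x + prophetReward z :=
  prophetReward_le_iff.2 fun i => add_le_add (le_prophetReward x i) (le_prophetReward z i)

lemma measurable_prophetReward : Measurable (prophetReward (n := n)) :=
  (Continuous.finset_sup_apply fun i _ => continuous_apply i).measurable

lemma optionValues_apply (A : Matrix (Fin n) (Fin m) ℝ≥0) (y : Fin m → ℝ≥0) (i : Fin n) :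
    optionValues A y i = ∑ j, A i j * y j := rfl

lemma optionValues_monotone (A : Matrix (Fin n) (Fin m) ℝ≥0) : Monotone (optionValues A) :=
  fun y z h i => by
    simp only [optionValues_apply]
    gcongr with j
    exact h j

lemma optionValues_add (A : Matrix (Fin n) (Fin m) ℝ≥0) (y z : Fin m → ℝ≥0) :
    optionValues A (y + z) = optionValues A y + optionValues A z :=
  A.mulVec_add y z

lemma measurable_optionValues (A : Matrix (Fin n) (Fin m) ℝ≥0) : Measurable (optionValues A) :=
  (continuous_const.matrix_mulVec continuous_id).measurable

lemma prophetReward_optionValues_monotone (A : Matrix (Fin n) (Fin m) ℝ≥0) :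
    Monotone fun y => prophetReward (optionValues A y) :=
  prophetReward_monotone.comp (optionValues_monotone A)

lemma measurable_prophetReward_optionValues (A : Matrix (Fin n) (Fin m) ℝ≥0) :
    Measurable fun y => prophetReward (optionValues A y) :=
  measurable_prophetReward.comp (measurable_optionValues A)

lemma prophetReward_optionValues_add_le (A : Matrix (Fin n) (Fin m) ℝ≥0) (y z : Fin m → ℝ≥0) :
    prophetReward (optionValues A (y + z)) ≤
      prophetReward (optionValues A y) + prophetReward (optionValues A z) := by
  rw [optionValues_add]
  exact prophetReward_add_le _ _

lemma IsUnweighted.le_one (hA : IsUnweighted A) (i : Fin n) (j : Fin m) : A i j ≤ 1 := by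
  rcases hA i j with h | h <;> simp [h]

lemma isSubadditiveFunctional_prophetReward_truncation (hA : ∀ i j, A i j ≤ 1) (τ : ℝ≥0) :
    IsSubadditiveFunctional τ fun y : Fin m → ℝ≥0 =>
      prophetReward (optionValues A fun j => min (y j) τ) where
  measurable := (measurable_prophetReward_optionValues A).comp <|
    measurable_pi_lambda _ fun j => (measurable_pi_apply j).min measurable_const
  monotone _ _ h := prophetReward_optionValues_monotone A fun j => min_le_min_right τ (h j)
  map_zero := nonpos_iff_eq_zero.1 <| prophetReward_le_iff.2 fun i => by simp [optionValues_apply]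
  map_add_le y z := by
    refine le_trans (prophetReward_optionValues_monotone A fun j => ?_)
      (prophetReward_optionValues_add_le A _ _)
    change min (y j + z j) τ ≤ min (y j) τ + min (z j) τ
    rcases le_total (y j) τ with hy | hy
    · rcases le_total (z j) τ with hz | hz
      · simp [hy, hz]
      · simp [hz]
    · simp [hy]
  map_single_le k c := by
    refine prophetReward_le_iff.2 fun i => ?_
    rw [optionValues_apply, Finset.sum_eq_single k (fun j _ hj => by simp [hj]) (by simp)]
    exact (mul_le_of_le_one_left zero_le (hA i k)).trans (min_le_right _ _)

/-- The features that enter some option. The other ones are invisible both to the prophet and to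
the algorithm. -/
noncomputable def usedFeatures (A : Matrix (Fin n) (Fin m) ℝ≥0) : Finset (Fin m) :=
  {j | ∃ i, A i j ≠ 0}

lemma mem_usedFeatures {j : Fin m} : j ∈ usedFeatures A ↔ ∃ i, A i j ≠ 0 := by
  simp [usedFeatures]

lemma prophetReward_optionValues_le_sum (hA : ∀ i j, A i j ≤ 1) (y : Fin m → ℝ≥0) :
    prophetReward (optionValues A y) ≤ ∑ j ∈ usedFeatures A, y j := by
  refine prophetReward_le_iff.2 fun i => ?_
  calc optionValues A y i = ∑ j, A i j * y j := optionValues_apply A y i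
    _ = ∑ j ∈ usedFeatures A, A i j * y j := by
        refine (Finset.sum_subset (Finset.subset_univ (usedFeatures A)) fun j _ hj => ?_).symm
        have hzero : A i j = 0 := by
          by_contra h
          exact hj (mem_usedFeatures.2 ⟨i, h⟩)
        rw [hzero, zero_mul]
    _ ≤ ∑ j ∈ usedFeatures A, y j :=
        Finset.sum_le_sum fun j _ => mul_le_of_le_one_left zero_le (hA i j)

lemma prophetReward_le_truncation_add_excess (hA : ∀ i j, A i j ≤ 1) (τ : ℝ≥0)
    (y : Fin m → ℝ≥0) :
    prophetReward (optionValues A y) ≤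
      prophetReward (optionValues A fun j => min (y j) τ) + ∑ j ∈ usedFeatures A, (y j - τ) := by
  have hy : y = (fun j => min (y j) τ) + fun j => y j - τ := by
    ext j
    rw [Pi.add_apply, add_comm, tsub_add_min]
  calc prophetReward (optionValues A y)
      = prophetReward (optionValues A ((fun j => min (y j) τ) + fun j => y j - τ)) := by rw [← hy]
    _ ≤ prophetReward (optionValues A fun j => min (y j) τ) +
          prophetReward (optionValues A fun j => y j - τ) :=
        prophetReward_optionValues_add_le A _ _
    _ ≤ _ := by gcongr; exact prophetReward_optionValues_le_sum hA _

lemma IsUnweighted.eq_one (hA : IsUnweighted A) {i : Fin n} {j : Fin m} (h : A i j ≠ 0) :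
    A i j = 1 :=
  (hA i j).resolve_left h

lemma IsUnweighted.le_optionValues (hA : IsUnweighted A) {i : Fin n} {j : Fin m} (h : A i j ≠ 0)
    (y : Fin m → ℝ≥0) : y j ≤ optionValues A y i :=
  calc y j = A i j * y j := by rw [hA.eq_one h, one_mul]
    _ ≤ ∑ k, A i k * y k :=
        Finset.single_le_sum_of_canonicallyOrdered (f := fun k => A i k * y k) (Finset.mem_univ j)
    _ = optionValues A y i := rfl

lemma optionValues_indicator_compl_singleton {i : Fin n} {j : Fin m} (h : A i j = 0)
    (y : Fin m → ℝ≥0) :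
    optionValues A (({j}ᶜ : Set (Fin m)).indicator y) i = optionValues A y i := by
  simp only [optionValues_apply]
  refine Finset.sum_congr rfl fun k _ => ?_
  by_cases hk : k = j <;> simp [hk, h]

lemma le_fixedThresholdReward {τ c : ℝ≥0} {x : Fin n → ℝ≥0} (hτ : τ < prophetReward x)
    (hc : ∀ i, τ < x i → c ≤ x i) : c ≤ fixedThresholdReward τ x := by
  have hex : ∃ i, τ < x i := by simpa [prophetReward_le_iff] using hτ.not_ge
  rw [fixedThresholdReward, dif_pos hex]
  exact hc _ (Fin.find_spec hex)

/-- The event that the features other than `j` keep every option at or below `τ`. It does not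
involve `y j`, and on it an option above `τ` must contain feature `j`. -/
def othersBelow (A : Matrix (Fin n) (Fin m) ℝ≥0) (τ : ℝ≥0) (j : Fin m) : Set (Fin m → ℝ≥0) :=
  {y | prophetReward (optionValues A (({j}ᶜ : Set (Fin m)).indicator y)) ≤ τ}

lemma measurableSet_othersBelow (A : Matrix (Fin n) (Fin m) ℝ≥0) (τ : ℝ≥0) (j : Fin m) :
    MeasurableSet (othersBelow A τ j) :=
  measurableSet_le
    ((measurable_prophetReward_optionValues A).comp (measurable_indicator_pi _)) measurable_const

lemma IsUnweighted.le_of_mem_othersBelow (hA : IsUnweighted A) {τ : ℝ≥0} {y : Fin m → ℝ≥0}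
    {j k : Fin m} (hy : y ∈ othersBelow A τ j) (hk : k ∈ usedFeatures A) (hkj : k ≠ j) :
    y k ≤ τ := by
  obtain ⟨i, hi⟩ := mem_usedFeatures.1 hk
  calc y k = ({j}ᶜ : Set (Fin m)).indicator y k := by simp [hkj]
    _ ≤ optionValues A (({j}ᶜ : Set (Fin m)).indicator y) i := hA.le_optionValues hi _
    _ ≤ τ := prophetReward_le_iff.1 hy i

lemma IsUnweighted.le_fixedThresholdReward_of_mem_othersBelow (hA : IsUnweighted A) {τ : ℝ≥0}
    {y : Fin m → ℝ≥0} {j : Fin m} (hj : j ∈ usedFeatures A) (hτ : τ < y j)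
    (hy : y ∈ othersBelow A τ j) : y j ≤ fixedThresholdReward τ (optionValues A y) := by
  obtain ⟨i₀, hi₀⟩ := mem_usedFeatures.1 hj
  refine le_fixedThresholdReward
    (hτ.trans_le ((hA.le_optionValues hi₀ y).trans (le_prophetReward _ i₀))) fun i hi => ?_
  refine hA.le_optionValues (fun hzero => hi.not_ge ?_) y
  rw [← optionValues_indicator_compl_singleton hzero]
  exact prophetReward_le_iff.1 hy i

lemma IsUnweighted.sum_excess_le_fixedThresholdReward (hA : IsUnweighted A) (τ : ℝ≥0)
    (y : Fin m → ℝ≥0) :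
    ∑ j ∈ usedFeatures A, (othersBelow A τ j).indicator (fun y => y j - τ) y ≤
      fixedThresholdReward τ (optionValues A y) := by
  by_cases hex : ∃ j ∈ usedFeatures A, y ∈ othersBelow A τ j ∧ τ < y j
  · obtain ⟨j, hj, hy, hτ⟩ := hex
    have hother : ∀ k ∈ usedFeatures A, k ≠ j →
        (othersBelow A τ k).indicator (fun y => y k - τ) y = 0 := fun k hk hkj =>
      Set.indicator_apply_eq_zero.2 fun _ =>
        tsub_eq_zero_of_le (hA.le_of_mem_othersBelow hy hk hkj)
    rw [Finset.sum_eq_single_of_mem j hj hother, Set.indicator_of_mem hy]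
    exact tsub_le_self.trans (hA.le_fixedThresholdReward_of_mem_othersBelow hj hτ hy)
  · push Not at hex
    have hzero : ∀ j ∈ usedFeatures A, (othersBelow A τ j).indicator (fun y => y j - τ) y = 0 :=
      fun j hj => Set.indicator_apply_eq_zero.2 fun hy => tsub_eq_zero_of_le (hex j hj hy)
    rw [Finset.sum_eq_zero hzero]
    exact zero_le

end Options

section Expectation

variable {n m : ℕ} {A : Matrix (Fin n) (Fin m) ℝ≥0} {D : Fin m → Measure ℝ≥0}
  [∀ j, IsProbabilityMeasure (D j)] {τ : ℝ≥0}

lemma measurable_excess (τ : ℝ≥0) (j : Fin m) :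
    Measurable fun y : Fin m → ℝ≥0 => ((y j - τ : ℝ≥0) : ℝ≥0∞) :=
  ((measurable_id.sub_const τ).comp (measurable_pi_apply j)).coe_nnreal_ennreal

lemma lintegral_prophetReward_le_add_sum_excess (hA : ∀ i j, A i j ≤ 1)
    (hmed : Measure.pi D {y | τ < prophetReward (optionValues A y)} ≤ 1 / 2) :
    ∫⁻ y, prophetReward (optionValues A y) ∂Measure.pi D ≤
      4 * τ + ∑ j ∈ usedFeatures A, ∫⁻ y, (y j - τ : ℝ≥0) ∂Measure.pi D := by
  have hF := isSubadditiveFunctional_prophetReward_truncation hA τ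
  have hmed' : Measure.pi D {y | τ < prophetReward (optionValues A fun j => min (y j) τ)} ≤ 1 / 2 :=
    (measure_mono fun y hy => lt_of_lt_of_le hy
      (prophetReward_optionValues_monotone A fun j => min_le_left (y j) τ)).trans hmed
  calc ∫⁻ y, prophetReward (optionValues A y) ∂Measure.pi D
      ≤ ∫⁻ y, ((prophetReward (optionValues A fun j => min (y j) τ) : ℝ≥0∞) +
          ∑ j ∈ usedFeatures A, ((y j - τ : ℝ≥0) : ℝ≥0∞)) ∂Measure.pi D :=
        lintegral_mono fun y => by
          rw [← ENNReal.ofNNReal_finsetSum, ← ENNReal.coe_add]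
          exact ENNReal.coe_le_coe.2 (prophetReward_le_truncation_add_excess hA τ y)
    _ = ∫⁻ y, prophetReward (optionValues A fun j => min (y j) τ) ∂Measure.pi D +
          ∑ j ∈ usedFeatures A, ∫⁻ y, (y j - τ : ℝ≥0) ∂Measure.pi D := by
        rw [lintegral_add_left hF.measurable.coe_nnreal_ennreal,
          lintegral_finsetSum _ fun j _ => measurable_excess τ j]
    _ ≤ _ := by gcongr; exact hF.lintegral_le_four_mul hmed'

lemma one_half_le_measure_othersBelow
    (hmed : Measure.pi D {y | τ < prophetReward (optionValues A y)} ≤ 1 / 2) (j : Fin m) :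
    1 / 2 ≤ Measure.pi D (othersBelow A τ j) := by
  have hcompl : Measure.pi D (othersBelow A τ j)ᶜ ≤ 1 / 2 := by
    refine (measure_mono fun y hy => ?_).trans hmed
    have habove : τ < prophetReward (optionValues A (({j}ᶜ : Set (Fin m)).indicator y)) :=
      not_le.1 hy
    exact habove.trans_le (prophetReward_optionValues_monotone A (Set.indicator_le_self _ y))
  rw [prob_compl_eq_one_sub (measurableSet_othersBelow A τ j), tsub_le_iff_left] at hcompl
  rw [← ENNReal.add_le_add_iff_right (a := 1 / 2) (by simp), ENNReal.add_halves]
  exact hcompl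

lemma setLIntegral_othersBelow_excess (A : Matrix (Fin n) (Fin m) ℝ≥0) (τ : ℝ≥0) (j : Fin m) :
    ∫⁻ y in othersBelow A τ j, (y j - τ : ℝ≥0) ∂Measure.pi D =
      Measure.pi D (othersBelow A τ j) * ∫⁻ y, (y j - τ : ℝ≥0) ∂Measure.pi D := by
  have hindep : IndepFun (fun y : Fin m → ℝ≥0 => ((y j - τ : ℝ≥0) : ℝ≥0∞))
      (fun y => ({j}ᶜ : Set (Fin m)).indicator y) (Measure.pi D) := by
    simpa [Function.comp_def] using
      (indepFun_indicator_pi (D := D) (disjoint_compl_right (a := ({j} : Set (Fin m))))).comp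
        (measurable_excess τ j) measurable_id
  exact setLIntegral_preimage_of_indepFun (measurable_excess τ j) (measurable_indicator_pi _) hindep
    (measurableSet_le (measurable_prophetReward_optionValues A) measurable_const)

lemma IsUnweighted.half_mul_sum_lintegral_excess_le (hA : IsUnweighted A)
    (hmed : Measure.pi D {y | τ < prophetReward (optionValues A y)} ≤ 1 / 2) :
    1 / 2 * ∑ j ∈ usedFeatures A, ∫⁻ y, (y j - τ : ℝ≥0) ∂Measure.pi D ≤
      ∫⁻ y, fixedThresholdReward τ (optionValues A y) ∂Measure.pi D := by
  have hmeas (j : Fin m) : Measurable fun y =>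
      (((othersBelow A τ j).indicator (fun y => y j - τ) y : ℝ≥0) : ℝ≥0∞) := by
    simpa only [ENNReal.coe_indicator] using
      (measurable_excess τ j).indicator (measurableSet_othersBelow A τ j)
  calc 1 / 2 * ∑ j ∈ usedFeatures A, ∫⁻ y, (y j - τ : ℝ≥0) ∂Measure.pi D
      ≤ ∑ j ∈ usedFeatures A, ∫⁻ y in othersBelow A τ j, (y j - τ : ℝ≥0) ∂Measure.pi D := by
        rw [Finset.mul_sum]
        gcongr with j
        rw [setLIntegral_othersBelow_excess]
        gcongr
        exact one_half_le_measure_othersBelow hmed j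
    _ = ∫⁻ y, ∑ j ∈ usedFeatures A,
          ((othersBelow A τ j).indicator (fun y => y j - τ) y : ℝ≥0) ∂Measure.pi D := by
        rw [lintegral_finsetSum _ fun j _ => hmeas j]
        exact Finset.sum_congr rfl fun j _ => by
          simp only [ENNReal.coe_indicator,
            lintegral_indicator (measurableSet_othersBelow A τ j)]
    _ ≤ ∫⁻ y, fixedThresholdReward τ (optionValues A y) ∂Measure.pi D :=
        lintegral_mono fun y => by
          rw [← ENNReal.ofNNReal_finsetSum]
          exact ENNReal.coe_le_coe.2 (hA.sum_excess_le_fixedThresholdReward τ y)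

lemma mul_measure_lt_le_lintegral_fixedThresholdReward {Ω : Type*} [MeasurableSpace Ω]
    (μ : Measure Ω) {X : Ω → Fin n → ℝ≥0} (hX : Measurable X) (τ : ℝ≥0) :
    τ * μ {ω | τ < prophetReward (X ω)} ≤ ∫⁻ ω, fixedThresholdReward τ (X ω) ∂μ := by
  have hmeas : MeasurableSet {ω | τ < prophetReward (X ω)} :=
    measurableSet_lt measurable_const (measurable_prophetReward.comp hX)
  rw [← lintegral_indicator_const hmeas]
  exact lintegral_mono <| Set.indicator_le fun ω hω =>
    ENNReal.coe_le_coe.2 (le_fixedThresholdReward hω fun _ hi => hi.le)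

lemma le_four_mul_lintegral_fixedThresholdReward_half {Ω : Type*} [MeasurableSpace Ω]
    {μ : Measure Ω} {X : Ω → Fin n → ℝ≥0} (hX : Measurable X)
    (hmed : ∀ t < τ, 1 / 2 < μ {ω | t < prophetReward (X ω)}) :
    τ ≤ 4 * ∫⁻ ω, fixedThresholdReward (τ / 2) (X ω) ∂μ := by
  rcases eq_or_ne τ 0 with rfl | hτ
  · simp
  have hτ' : (τ : ℝ≥0∞) = 4 * ((τ / 2 : ℝ≥0) * (1 / 2 : ℝ≥0)) := by
    rw [← ENNReal.coe_mul, ← ENNReal.coe_ofNat, ← ENNReal.coe_mul]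
    congr 1
    ext
    push_cast
    ring
  rw [hτ']
  gcongr
  refine le_trans ?_ (mul_measure_lt_le_lintegral_fixedThresholdReward μ hX (τ / 2))
  gcongr
  simpa using (hmed (τ / 2) (NNReal.half_lt_self hτ)).le

variable (D) in
theorem IsUnweighted.exists_threshold (hA : IsUnweighted A) :
    ∃ τ : ℝ≥0, ∫⁻ y, prophetReward (optionValues A y) ∂Measure.pi D ≤
      18 * ∫⁻ y, fixedThresholdReward τ (optionValues A y) ∂Measure.pi D := by
  obtain ⟨τ, hmed, hleast⟩ := exists_isLeast_measure_lt_le (μ := Measure.pi D)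
    (measurable_prophetReward_optionValues A) (p := 1 / 2) (by simp)
  have hlow : ∀ t < τ, 1 / 2 < Measure.pi D {y | t < prophetReward (optionValues A y)} :=
    fun t ht => not_le.1 fun h => ht.not_ge (hleast h)
  set alg : ℝ≥0 → ℝ≥0∞ := fun t => ∫⁻ y, fixedThresholdReward t (optionValues A y) ∂Measure.pi D
  set excess := ∑ j ∈ usedFeatures A, ∫⁻ y, (y j - τ : ℝ≥0) ∂Measure.pi D
  have hτ : τ ≤ 4 * alg (τ / 2) :=
    le_four_mul_lintegral_fixedThresholdReward_half (measurable_optionValues A) hlow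
  have hexcess : excess ≤ 2 * alg τ := by
    rw [mul_comm, ← ENNReal.div_le_iff_le_mul (by simp) (by simp), ENNReal.div_eq_inv_mul,
      ← one_div]
    exact hA.half_mul_sum_lintegral_excess_le hmed
  have hsum : ∫⁻ y, prophetReward (optionValues A y) ∂Measure.pi D ≤
      16 * alg (τ / 2) + 2 * alg τ :=
    calc _ ≤ 4 * τ + excess := lintegral_prophetReward_le_add_sum_excess hA.le_one hmed
      _ ≤ 4 * (4 * alg (τ / 2)) + 2 * alg τ := by gcongr
      _ = 16 * alg (τ / 2) + 2 * alg τ := by ring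
  rcases le_total (alg τ) (alg (τ / 2)) with h | h
  · refine ⟨τ / 2, hsum.trans ?_⟩
    calc 16 * alg (τ / 2) + 2 * alg τ ≤ 16 * alg (τ / 2) + 2 * alg (τ / 2) := by gcongr
      _ = 18 * alg (τ / 2) := by ring
  · refine ⟨τ, hsum.trans ?_⟩
    calc 16 * alg (τ / 2) + 2 * alg τ ≤ 16 * alg τ + 2 * alg τ := by gcongr
      _ = 18 * alg τ := by ring

end Expectation

end LinearProphet

theorem mainTheorem9 :
    ∃ α : ℝ≥0, 1 ≤ α ∧
      ∀ (n m : ℕ) (A : Matrix (Fin n) (Fin m) ℝ≥0) (D : Fin m → Measure ℝ≥0)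
        [∀ j, IsProbabilityMeasure (D j)],
        LinearProphet.IsUnweighted A →
        ∃ τ : ℝ≥0,
          ∀ {Ω : Type*} [MeasurableSpace Ω] (P : Measure Ω) [IsProbabilityMeasure P]
            (Y : Fin m → Ω → ℝ≥0),
            (∀ j, HasLaw (Y j) (D j) P) → iIndepFun Y P →
            (1 / (α : ℝ≥0∞)) *
                ∫⁻ ω, (LinearProphet.prophetReward
                  (LinearProphet.optionValues A fun j => Y j ω) : ℝ≥0∞) ∂P ≤
              ∫⁻ ω, (LinearProphet.fixedThresholdReward τ
                (LinearProphet.optionValues A fun j => Y j ω) : ℝ≥0∞) ∂P := by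
  refine ⟨18, by norm_num, fun n m A D _ hA => ?_⟩
  obtain ⟨τ, hτ⟩ := hA.exists_threshold D
  refine ⟨τ, fun P _ Y hY hindep => ?_⟩
  have hlaw : HasLaw (fun ω j => Y j ω) (Measure.pi D) P := hindep.hasLaw_pi hY
  rw [one_div, mul_comm, ← div_eq_mul_inv]
  refine ENNReal.div_le_of_le_mul' ?_
  calc ∫⁻ ω, LinearProphet.prophetReward (LinearProphet.optionValues A fun j => Y j ω) ∂P
      = ∫⁻ y, LinearProphet.prophetReward (LinearProphet.optionValues A y) ∂Measure.pi D :=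
        hlaw.lintegral_comp
          (LinearProphet.measurable_prophetReward_optionValues A).coe_nnreal_ennreal.aemeasurable
    _ ≤ 18 * ∫⁻ y, LinearProphet.fixedThresholdReward τ (LinearProphet.optionValues A y)
          ∂Measure.pi D := hτ
    _ ≤ 18 * ∫⁻ ω, LinearProphet.fixedThresholdReward τ
          (LinearProphet.optionValues A fun j => Y j ω) ∂P := by
        gcongr
        rw [← hlaw.map_eq]
        exact lintegral_map_le _ _
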